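/- Let $A$ be a ring (associative, with unit). An $A$-coring is an $A$-bimodule $\mathfrak{C}$ with a coassociative, counital pair of $A$-bimodule maps $\Delta:\mathfrak{C}\to\mathfrak{C}\otimes_A\mathfrak{C}$, $\varepsilon:\mathfrak{C}\to A$; write $\Delta(c)=\sum c_{(1)}\otimes_A c_{(2)}$. A right $\mathfrak{C}$-comodule is a right $A$-module $M$ with a right $A$-linear, coassociative and counital coaction $M\to M\otimes_A\mathfrak{C}$, $m\mapsto\sum m_{(0)}\otimes_A m_{(1)}$, and $\mathrm{Hom}_{\mathfrak{C}}$ denotes the group of colinear maps. A right rational pairing $\mathcal{T}=(\mathfrak{C},B,\langle-,-\rangle)$ over $A$ consists of an $A$-coring $\mathfrak{C}$, a ring $B$ with a ring morphism $A\to B$, and an $A$-balanced $A$-bilinear form $\langle-,-\rangle:\mathfrak{C}\times B\to A$ such that $b\mapsto\langle-,b\rangle$ is an anti-morphism of rings from $B$ to the left dual ring ${}^*\mathfrak{C}=\mathrm{Hom}({}_A\mathfrak{C},{}_AA)$ (with product $(f*g)(c)=\sum f(c_{(1)}g(c_{(2)}))$ and unit $\varepsilon$), and such that for every right $A$-module $M$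 the map $M\otimes_A\mathfrak{C}\to\mathrm{Hom}(B_A,M_A)$, $m\otimes_A c\mapsto[b\mapsto m\langle c,b\rangle]$, is injective. Every right $\mathfrak{C}$-comodule $M$ is then a right $B$-module by $mb=\sum m_{(0)}\langle m_{(1)},b\rangle$. For a right $B$-module $M$, let $\mathrm{Rat}^{\mathcal{T}}(M)$ be the set of all $m\in M$ for which there are finitely many $c_i\in\mathfrak{C}$, $m_i\in M$ with $mb=\sum_i m_i\langle c_i,b\rangle$ for all $b\in B$. It is a $B$-submodule of $M$, the elements $m_i$ can be chosen in it, and it is a right $\mathfrak{C}$-comodule by $m\mapsto\sum_i m_i\otimes_A c_i$. This defines the rational functor $\mathrm{Rat}^{\mathcal{T}}$ from right $B$-modules to right $\mathfrak{C}$-comodules. Let $\Sigma$ be a right $\mathfrak{C}$-comodule that is finitely generated and projective in the category of right $\mathfrak{C}$-comodules, with endomorphism ring $T_\Sigma=\mathrm{End}_{\mathfrak{C}}(\Sigma)$. Then $\mathrm{Hom}_{\mathfrak{C}}(\Sigma,M)$ is a right $T_\Sigma$-module by composition, for every comodule $M$. Let $\Sigma^\star=\mathrm{Hom}_B(\Sigma,B)$,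 a $(B,T_\Sigma)$-bimodule, and for a right $T_\Sigma$-module $Y$ put $$\mathrm{Coind}_\Sigma(Y)=\mathrm{Rat}^{\mathcal{T}}\big(\mathrm{Hom}_{T_\Sigma}(\Sigma^\star,Y)\big).$$ Let $\mathcal{C}_\Sigma$ be the class of comodules $L$ with $\mathrm{Hom}_{\mathfrak{C}}(\Sigma,L)=0$, let $\mathcal{T}_\Sigma$ be the class of comodules $N$ with $\mathrm{Hom}_{\mathfrak{C}}(N,L)=0$ for all $L\in\mathcal{C}_\Sigma$, and for a comodule $M$ let $\mathfrak{r}_\Sigma(M)$ be the subcomodule of $M$ that is the sum of the images of all colinear maps $N\to M$ with $N\in\mathcal{T}_\Sigma$. **Corollary.** Suppose that the functor $\mathrm{Rat}^{\mathcal{T}}$ is exact. Then $\mathrm{Hom}_{\mathfrak{C}}(\Sigma,S)$ is a simple right $T_\Sigma$-module for every simple right $\mathfrak{C}$-comodule $S$ with $\mathrm{Hom}_{\mathfrak{C}}(\Sigma,S)\neq 0$, and $$[S]\longmapsto[\mathrm{Hom}_{\mathfrak{C}}(\Sigma,S)]$$ is a bijection from the isomorphism classes of simple right $\mathfrak{C}$-comodules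 $S$ with $\mathrm{Hom}_{\mathfrak{C}}(\Sigma,S)\neq0$ to the isomorphism classes of simple right $T_\Sigma$-modules. Its inverse is $[Y]\mapsto[\mathfrak{r}_\Sigma(\mathrm{Coind}_\Sigma(Y))]$; in particular, for every simple right $T_\Sigma$-module $Y$, the comodule $\mathfrak{r}_\Sigma(\mathrm{Coind}_\Sigma(Y))$ is simple and $\mathrm{Hom}_{\mathfrak{C}}(\Sigma,\mathfrak{r}_\Sigma(\mathrm{Coind}_\Sigma(Y)))\neq 0$. -/

import Mathlib

open MulOpposite

universe u

noncomputable section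

namespace Corings

/-! ### Tensor products over a noncommutative ring

A right `A`-module is a `Module Aᵐᵒᵖ M`; an `A`-bimodule is a left module and a right module whose
actions commute. -/

section Tensor

variable (A : Type*) [Ring A]

/-- The subgroup of `M ⊗_ℤ P` generated by all `(m a) ⊗ p - m ⊗ (a p)`. -/
def balancedRel (M P : Type*) [AddCommGroup M] [Module Aᵐᵒᵖ M] [AddCommGroup P] [Module A P] :
    AddSubgroup (TensorProduct ℤ M P) :=
  AddSubgroup.closure {x | ∃ (m : M) (a : A) (p : P),
    x = TensorProduct.tmul ℤ (op a • m) p - TensorProduct.tmul ℤ m (a • p)}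

/-- The tensor product `M ⊗_A P` of a right `A`-module `M` and a left `A`-module `P`. -/
def BTensor (M P : Type*) [AddCommGroup M] [Module Aᵐᵒᵖ M] [AddCommGroup P] [Module A P] :=
  TensorProduct ℤ M P ⧸ balancedRel A M P

variable {A}
variable {M N P Q : Type*} [AddCommGroup M] [Module Aᵐᵒᵖ M] [AddCommGroup N] [Module Aᵐᵒᵖ N]
  [AddCommGroup P] [Module A P] [AddCommGroup Q] [Module A Q]

namespace BTensor

instance : AddCommGroup (BTensor A M P) :=
  inferInstanceAs (AddCommGroup (TensorProduct ℤ M P ⧸ balancedRel A M P))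

variable (A M P) in
/-- The universal biadditive map `(m, p) ↦ m ⊗ p`. -/
def tmulHom : M →+ P →+ BTensor A M P :=
  AddMonoidHom.mk' (fun m => AddMonoidHom.mk'
      (fun p => (QuotientAddGroup.mk' (balancedRel A M P)) (TensorProduct.tmul ℤ m p))
      (fun p q => by rw [TensorProduct.tmul_add]; rfl))
    (fun m n => by
      ext p
      change QuotientAddGroup.mk' _ (TensorProduct.tmul ℤ (m + n) p) = _
      rw [TensorProduct.add_tmul]; rfl)

variable (A) in
/-- The pure tensor `m ⊗ p` in `M ⊗_A P`. -/
def tmul (m : M) (p : P) : BTensor A M P := tmulHom A M P m p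

theorem tmulHom_apply (m : M) (p : P) : tmulHom A M P m p = tmul A m p := rfl

theorem tmul_balanced (m : M) (a : A) (p : P) : tmul A (op a • m) p = tmul A m (a • p) := by
  have h : TensorProduct.tmul ℤ (op a • m) p - TensorProduct.tmul ℤ m (a • p) ∈ balancedRel A M P :=
    AddSubgroup.subset_closure ⟨m, a, p, rfl⟩
  exact QuotientAddGroup.eq_iff_sub_mem.2 h

theorem add_tmul (m m' : M) (p : P) : tmul A (m + m') p = tmul A m p + tmul A m' p := by
  simp [← tmulHom_apply]

theorem tmul_add (m : M) (p p' : P) : tmul A m (p + p') = tmul A m p + tmul A m p' := by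
  simp [← tmulHom_apply]

theorem induction_on {motive : BTensor A M P → Prop} (x : BTensor A M P)
    (h : ∀ m p, motive (tmul A m p)) (ha : ∀ x y, motive x → motive y → motive (x + y)) :
    motive x := by
  obtain ⟨t, rfl⟩ := QuotientAddGroup.mk'_surjective (balancedRel A M P) x
  induction t with
  | zero =>
    have := h 0 0
    rwa [← tmulHom_apply, map_zero] at this
  | tmul m p => exact h m p
  | add x y hx hy => rw [map_add]; exact ha _ _ hx hy

/-- The universal property of `M ⊗_A P`. -/
def lift {G : Type*} [AddCommGroup G] (f : M →+ P →+ G)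
    (hf : ∀ m (a : A) p, f (op a • m) p = f m (a • p)) : BTensor A M P →+ G :=
  QuotientAddGroup.lift (balancedRel A M P)
    (TensorProduct.liftAddHom f (fun r m n => by
      rw [map_zsmul, AddMonoidHom.coe_smul, Pi.smul_apply, map_zsmul]))
    (by
      rw [balancedRel, AddSubgroup.closure_le]
      rintro _ ⟨m, a, p, rfl⟩
      simp [hf])

@[simp]
theorem lift_tmul {G : Type*} [AddCommGroup G] (f : M →+ P →+ G)
    (hf : ∀ m (a : A) p, f (op a • m) p = f m (a • p)) (m : M) (p : P) :
    lift f hf (tmul A m p) = f m p := rfl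

/-- The map `f ⊗ g : M ⊗_A P → N ⊗_A Q`. -/
def map (f : M →ₗ[Aᵐᵒᵖ] N) (g : P →ₗ[A] Q) : BTensor A M P →+ BTensor A N Q :=
  lift (AddMonoidHom.mk' (fun m => ((tmulHom A N Q) (f m)).comp g.toAddMonoidHom)
      (fun m m' => by ext p; simp))
    (fun m a p => by simp [tmulHom_apply, tmul_balanced])

@[simp]
theorem map_tmul (f : M →ₗ[Aᵐᵒᵖ] N) (g : P →ₗ[A] Q) (m : M) (p : P) :
    map f g (tmul A m p) = tmul A (f m) (g p) := rfl

theorem map_id (x : BTensor A M P) : map LinearMap.id LinearMap.id x = x := by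
  induction x using induction_on with
  | h m p => rfl
  | ha x y hx hy => rw [map_add, hx, hy]

theorem map_map {N' Q' : Type*} [AddCommGroup N'] [Module Aᵐᵒᵖ N'] [AddCommGroup Q'] [Module A Q']
    (f : M →ₗ[Aᵐᵒᵖ] N) (g : P →ₗ[A] Q) (f' : N →ₗ[Aᵐᵒᵖ] N') (g' : Q →ₗ[A] Q')
    (x : BTensor A M P) : map f' g' (map f g x) = map (f' ∘ₗ f) (g' ∘ₗ g) x := by
  induction x using induction_on with
  | h m p => rfl
  | ha x y hx hy => simp only [map_add, hx, hy]

theorem map_add_left (f f' : M →ₗ[Aᵐᵒᵖ] N) (g : P →ₗ[A] Q) (x : BTensor A M P) :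
    map (f + f') g x = map f g x + map f' g x := by
  induction x using induction_on with
  | h m p => simp [add_tmul]
  | ha x y hx hy => simp only [map_add, hx, hy]; abel

theorem map_zero_left (g : P →ₗ[A] Q) (x : BTensor A M P) :
    map (0 : M →ₗ[Aᵐᵒᵖ] N) g x = 0 := by
  have := map_add_left (0 : M →ₗ[Aᵐᵒᵖ] N) 0 g x
  simpa using this

theorem map_add_right (f : M →ₗ[Aᵐᵒᵖ] N) (g g' : P →ₗ[A] Q) (x : BTensor A M P) :
    map f (g + g') x = map f g x + map f g' x := by
  induction x using induction_on with
  | h m p => simp [tmul_add]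
  | ha x y hx hy => simp only [map_add, hx, hy]; abel

theorem map_zero_right (f : M →ₗ[Aᵐᵒᵖ] N) (x : BTensor A M P) :
    map f (0 : P →ₗ[A] Q) x = 0 := by
  have := map_add_right f (0 : P →ₗ[A] Q) 0 x
  simpa using this

theorem map_neg_left (f : M →ₗ[Aᵐᵒᵖ] N) (g : P →ₗ[A] Q) (x : BTensor A M P) :
    map (-f) g x = - map f g x := by
  rw [eq_neg_iff_add_eq_zero, ← map_add_left, neg_add_cancel, map_zero_left]

section RightAction

variable [Module Aᵐᵒᵖ P] [SMulCommClass A Aᵐᵒᵖ P]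

/-- If `P` is a bimodule, then `M ⊗_A P` is a right `A`-module: `(m ⊗ p) a = m ⊗ (p a)`. -/
instance rightModule : Module Aᵐᵒᵖ (BTensor A M P) :=
  haveI : SMulCommClass Aᵐᵒᵖ A P := SMulCommClass.symm _ _ _
  { smul := fun r x => map LinearMap.id (Module.toModuleEnd A (S := Aᵐᵒᵖ) P r) x
    one_smul := fun x => by
      change map _ _ x = x
      rw [map_one]; exact map_id x
    mul_smul := fun r s x => by
      change map _ _ x = map _ _ (map _ _ x)
      rw [map_map, map_mul]; rfl
    smul_zero := fun r => map_zero _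
    smul_add := fun r x y => map_add _ x y
    add_smul := fun r s x => by
      change map _ _ x = map _ _ x + map _ _ x
      rw [map_add, map_add_right]
    zero_smul := fun x => by
      change map _ _ x = 0
      rw [map_zero, map_zero_right] }

@[simp]
theorem op_smul_tmul (r : Aᵐᵒᵖ) (m : M) (p : P) : r • tmul A m p = tmul A m (r • p) := rfl

end RightAction

section LeftAction

variable [Module A M] [SMulCommClass A Aᵐᵒᵖ M]

/-- If `M` is a bimodule, then `M ⊗_A P` is a left `A`-module: `a (m ⊗ p) = (a m) ⊗ p`. -/
instance leftModule : Module A (BTensor A M P) :=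
  { smul := fun r x => map (Module.toModuleEnd Aᵐᵒᵖ (S := A) M r) LinearMap.id x
    one_smul := fun x => by
      change map _ _ x = x
      rw [map_one]; exact map_id x
    mul_smul := fun r s x => by
      change map _ _ x = map _ _ (map _ _ x)
      rw [map_map, map_mul]; rfl
    smul_zero := fun r => map_zero _
    smul_add := fun r x y => map_add _ x y
    add_smul := fun r s x => by
      change map _ _ x = map _ _ x + map _ _ x
      rw [map_add, map_add_left]
    zero_smul := fun x => by
      change map _ _ x = 0
      rw [map_zero, map_zero_left] }

@[simp]
theorem smul_tmul (r : A) (m : M) (p : P) : r • tmul A m p = tmul A (r • m) p := rfl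

end LeftAction

/-- The map `M ⊗_A P → M`, `m ⊗ p ↦ m f(p)`, given by a left linear form `f : P → A`. -/
def contract (f : P →ₗ[A] A) : BTensor A M P →+ M :=
  lift (AddMonoidHom.mk' (fun m => AddMonoidHom.mk' (fun p => op (f p) • m)
      (fun p q => by simp [add_smul])) (fun m m' => by ext p; simp))
    (fun m a p => by simp [mul_smul])

@[simp]
theorem contract_tmul (f : P →ₗ[A] A) (m : M) (p : P) :
    contract f (tmul A m p) = op (f p) • m := rfl

theorem contract_map (f : Q →ₗ[A] A) (g : M →ₗ[Aᵐᵒᵖ] N) (h : P →ₗ[A] Q) (x : BTensor A M P) :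
    contract f (map g h x) = g (contract (f ∘ₗ h) x) := by
  induction x using induction_on with
  | h m p => simp
  | ha x y hx hy => simp only [map_add, hx, hy]

/-- `contract` as a left linear map when `M` is a bimodule. -/
def contractL [Module A M] [SMulCommClass A Aᵐᵒᵖ M] (f : P →ₗ[A] A) : BTensor A M P →ₗ[A] M where
  toFun := contract f
  map_add' := map_add _
  map_smul' r x := by
    induction x using induction_on with
    | h m p => simp [smul_comm r (op (f p)) m]
    | ha x y hx hy => simp only [smul_add, map_add, hx, hy]

section Assoc

variable [Module Aᵐᵒᵖ P] [SMulCommClass A Aᵐᵒᵖ P]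

/-- The biadditive map `(m ⊗ p, q) ↦ m ⊗ (p ⊗ q)`. -/
def assocAux : BTensor A M P →+ Q →+ BTensor A M (BTensor A P Q) :=
  lift (AddMonoidHom.mk'
      (fun m => (AddMonoidHom.compHom (tmulHom A M (BTensor A P Q) m)).comp (tmulHom A P Q))
      (fun m m' => by ext p q; simp))
    (fun m a p => by
      ext q
      change tmul A (op a • m) (tmul A p q) = tmul A m (tmul A (a • p) q)
      rw [tmul_balanced, smul_tmul])

theorem assocAux_balanced (x : BTensor A M P) (a : A) (q : Q) :
    assocAux (op a • x) q = assocAux x (a • q) := by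
  induction x using induction_on with
  | h m p =>
    rw [op_smul_tmul]
    change tmul A m (tmul A (op a • p) q) = tmul A m (tmul A p (a • q))
    rw [tmul_balanced]
  | ha x y hx hy => rw [smul_add, map_add, map_add, AddMonoidHom.add_apply,
      AddMonoidHom.add_apply, hx, hy]

/-- The canonical map `(M ⊗_A P) ⊗_A Q → M ⊗_A (P ⊗_A Q)`, `(m ⊗ p) ⊗ q ↦ m ⊗ (p ⊗ q)`. -/
def assoc : BTensor A (BTensor A M P) Q →+ BTensor A M (BTensor A P Q) :=
  lift assocAux
    (fun x a q => assocAux_balanced x a q)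

@[simp]
theorem assoc_tmul (m : M) (p : P) (q : Q) :
    assoc (tmul A (tmul A m p) q) = tmul A m (tmul A p q) := rfl

theorem assoc_surjective :
    Function.Surjective (assoc : BTensor A (BTensor A M P) Q →+ BTensor A M (BTensor A P Q)) := by
  intro z
  induction z using induction_on with
  | h m t =>
    induction t using induction_on with
    | h p q => exact ⟨_, assoc_tmul m p q⟩
    | ha x y hx hy =>
      obtain ⟨x', hx⟩ := hx
      obtain ⟨y', hy⟩ := hy
      exact ⟨x' + y', by rw [map_add, hx, hy, tmul_add]⟩
  | ha x y hx hy =>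
    obtain ⟨x', hx⟩ := hx
    obtain ⟨y', hy⟩ := hy
    exact ⟨x' + y', by rw [map_add, hx, hy]⟩

theorem contract_op_smul (f : P →ₗ[A] A) (f' : P →ₗ[A] A) (a : A)
    (h : ∀ p, f (op a • p) = f' p) (x : BTensor A M P) :
    contract f (op a • x) = contract f' x := by
  induction x using induction_on with
  | h m p => simp [h]
  | ha x y hx hy => simp only [smul_add, map_add, hx, hy]

theorem contract_contract (f' : P →ₗ[A] A) (f : Q →ₗ[A] A) (y : BTensor A (BTensor A M P) Q) :
    contract f' (contract f y) = contract (f' ∘ₗ contractL f) (assoc y) := by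
  induction y using induction_on with
  | h x q =>
    induction x using induction_on with
    | h m p => simp [contractL]
    | ha x y hx hy => simp only [add_tmul, map_add, hx, hy]
  | ha x y hx hy => simp only [map_add, hx, hy]

end Assoc

/-- Right exactness, in the form that is needed to restrict coactions. -/
theorem mem_range_of_map_mkQ_eq_zero (L : Submodule Aᵐᵒᵖ M) (x : BTensor A M P)
    (hx : map L.mkQ (LinearMap.id : P →ₗ[A] P) x = 0) :
    x ∈ (map L.subtype (LinearMap.id : P →ₗ[A] P)).range := by
  set R := (map L.subtype (LinearMap.id : P →ₗ[A] P)).range with hR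
  let g : BTensor A (M ⧸ L) P →+ BTensor A M P ⧸ R :=
    lift (QuotientAddGroup.lift L.toAddSubgroup
        ((AddMonoidHom.compHom (QuotientAddGroup.mk' R)).comp (tmulHom A M P))
        (fun m hm => by
          ext p
          exact (QuotientAddGroup.eq_zero_iff _).2 ⟨tmul A ⟨m, hm⟩ p, rfl⟩))
      (fun m a p => by
        obtain ⟨m, rfl⟩ := L.mkQ_surjective m
        change QuotientAddGroup.mk' R (tmul A (op a • m) p)
          = QuotientAddGroup.mk' R (tmul A m (a • p))
        rw [tmul_balanced])
  have key : ∀ y : BTensor A M P, g (map L.mkQ LinearMap.id y) = QuotientAddGroup.mk' R y := by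
    intro y
    induction y using induction_on with
    | h m p => rfl
    | ha x y hx hy => simp only [map_add, hx, hy]
  have := key x
  rw [hx, map_zero] at this
  exact (QuotientAddGroup.eq_zero_iff _).1 this.symm

end BTensor

end Tensor

/-! ### Corings and comodules -/

/-- An `A`-coring: an `A`-bimodule `C` with bimodule maps `Δ : C → C ⊗_A C` and `ε : C → A` that
are coassociative and counital. -/
class Coring (A C : Type*) [Ring A] [AddCommGroup C] [Module A C] [Module Aᵐᵒᵖ C]
    [SMulCommClass A Aᵐᵒᵖ C] where
  comul : C →ₗ[A] BTensor A C C
  comul_op_smul : ∀ (r : Aᵐᵒᵖ) (c : C), comul (r • c) = r • comul c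
  counit : C →ₗ[A] A
  counit_op_smul : ∀ (a : A) (c : C), counit (op a • c) = counit c * a
  /-- `(Δ ⊗ C) Δ = (C ⊗ Δ) Δ`. -/
  coassoc : ∀ c : C,
    BTensor.assoc (BTensor.map
      ({ toFun := comul, map_add' := comul.map_add, map_smul' := comul_op_smul } :
        C →ₗ[Aᵐᵒᵖ] BTensor A C C) LinearMap.id (comul c))
      = BTensor.map LinearMap.id comul (comul c)
  /-- `(C ⊗ ε) Δ = C`. -/
  counit_right : ∀ c : C, BTensor.contract counit (comul c) = c
  /-- `(ε ⊗ C) Δ = C`. -/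
  counit_left : ∀ c : C,
    BTensor.lift (AddMonoidHom.mk' (fun x : C => DistribSMul.toAddMonoidHom C (counit x))
        (fun x y => by ext z; simp [add_smul]))
      (fun x a y => by simp [counit_op_smul, mul_smul]) (comul c) = c

section Comodules

variable (A C : Type u) [Ring A] [AddCommGroup C] [Module A C] [Module Aᵐᵒᵖ C]
  [SMulCommClass A Aᵐᵒᵖ C] [Coring A C]

/-- A right `C`-comodule: a right `A`-module `M` with a right `A`-linear, coassociative and
counital coaction `M → M ⊗_A C`. -/
structure RComod where
  carrier : Type u
  [addCommGroup : AddCommGroup carrier]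
  [module : Module Aᵐᵒᵖ carrier]
  coact : carrier →ₗ[Aᵐᵒᵖ] BTensor A carrier C
  /-- `(ρ ⊗ C) ρ = (M ⊗ Δ) ρ`. -/
  coassoc : ∀ m, BTensor.assoc (BTensor.map coact (LinearMap.id : C →ₗ[A] C) (coact m))
    = BTensor.map LinearMap.id Coring.comul (coact m)
  /-- `(M ⊗ ε) ρ = M`. -/
  counit : ∀ m, BTensor.contract Coring.counit (coact m) = m

variable {A C}

namespace RComod

instance : CoeSort (RComod A C) (Type u) := ⟨RComod.carrier⟩

instance (X : RComod A C) : AddCommGroup X := X.addCommGroup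

instance (X : RComod A C) : Module Aᵐᵒᵖ X := X.module

/-- The group `Hom_C(X, Y)` of right `C`-colinear maps. -/
def Hom (X Y : RComod A C) : AddSubgroup (X →ₗ[Aᵐᵒᵖ] Y) where
  carrier := {f | ∀ x, Y.coact (f x) = BTensor.map f (LinearMap.id : C →ₗ[A] C) (X.coact x)}
  zero_mem' x := by simp [BTensor.map_zero_left]
  add_mem' {f g} hf hg x := by
    rw [BTensor.map_add_left, LinearMap.add_apply, map_add, hf x, hg x]
  neg_mem' {f} hf x := by
    rw [BTensor.map_neg_left, LinearMap.neg_apply, map_neg, hf x]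

theorem comp_mem {X Y Z : RComod A C} {g : Y →ₗ[Aᵐᵒᵖ] Z} {f : X →ₗ[Aᵐᵒᵖ] Y}
    (hg : g ∈ Hom Y Z) (hf : f ∈ Hom X Y) : g ∘ₗ f ∈ Hom X Z := by
  intro x
  rw [LinearMap.comp_apply, hg, hf, BTensor.map_map, LinearMap.id_comp]

theorem id_mem (X : RComod A C) : LinearMap.id ∈ Hom X X := by
  intro x
  exact (BTensor.map_id _).symm

/-- The endomorphism ring `End_C(X)`, with composition as multiplication. -/
def EndRing (X : RComod A C) : Subring (Module.End Aᵐᵒᵖ X) where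
  carrier := {f | f ∈ Hom X X}
  mul_mem' hf hg := comp_mem hf hg
  one_mem' := id_mem X
  add_mem' hf hg := (Hom X X).add_mem hf hg
  zero_mem' := (Hom X X).zero_mem
  neg_mem' hf := (Hom X X).neg_mem hf

theorem mem_endRing {X : RComod A C} (t : X.EndRing) : (t : X →ₗ[Aᵐᵒᵖ] X) ∈ Hom X X := t.2

/-- `Hom_C(X, Y)` is a right `End_C(X)`-module: `f t = f ∘ t`. -/
instance (X Y : RComod A C) : Module (X.EndRing)ᵐᵒᵖ (Hom X Y) where
  smul t f := ⟨f.1 ∘ₗ t.unop.1, comp_mem f.2 (mem_endRing t.unop)⟩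
  one_smul _ := rfl
  mul_smul _ _ _ := rfl
  smul_zero _ := rfl
  smul_add _ _ _ := rfl
  add_smul _ _ _ := Subtype.ext (LinearMap.comp_add _ _ _)
  zero_smul _ := Subtype.ext (LinearMap.comp_zero _)

/-- Two comodules are isomorphic. -/
def IsIso (X Y : RComod A C) : Prop := ∃ e : X ≃ₗ[Aᵐᵒᵖ] Y, (e : X →ₗ[Aᵐᵒᵖ] Y) ∈ Hom X Y

theorem isIso_equivalence : Equivalence (IsIso (A := A) (C := C)) where
  refl X := ⟨LinearEquiv.refl _ _, id_mem X⟩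
  symm {X Y} := by
    rintro ⟨e, he⟩
    refine ⟨e.symm, fun y => ?_⟩
    obtain ⟨x, rfl⟩ := e.surjective y
    have h := he x
    simp only [LinearEquiv.coe_coe] at h ⊢
    rw [h, BTensor.map_map, LinearEquiv.symm_apply_apply, LinearEquiv.symm_comp,
      LinearMap.id_comp, BTensor.map_id]
  trans {X Y Z} := by
    rintro ⟨e, he⟩ ⟨e', he'⟩
    exact ⟨e.trans e', comp_mem he' he⟩

/-- A subcomodule: a right `A`-submodule `N` with `ρ(N)` inside the image of `N ⊗_A C`. -/
def IsSubcomodule (X : RComod A C) (N : Submodule Aᵐᵒᵖ X) : Prop :=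
  ∀ n ∈ N, X.coact n ∈ (BTensor.map N.subtype (LinearMap.id : C →ₗ[A] C)).range

/-- A simple comodule: nonzero, and without subcomodules other than `0` and itself. -/
def IsSimple (X : RComod A C) : Prop :=
  Nontrivial X ∧ ∀ N, X.IsSubcomodule N → N = ⊥ ∨ N = ⊤

/-- A projective comodule: colinear maps lift along surjective colinear maps. -/
def IsProjective (X : RComod A C) : Prop :=
  ∀ (Y Z : RComod A C) (p : Hom Y Z) (f : Hom X Z), Function.Surjective p.1 →
    ∃ g : Hom X Y, p.1 ∘ₗ g.1 = f.1

/-- A finitely generated comodule: if it is the union of a nonempty directed set of subcomodules,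
then it belongs to this set. -/
def IsFinGen (X : RComod A C) : Prop :=
  ∀ F : Set (Submodule Aᵐᵒᵖ X), F.Nonempty → (∀ N ∈ F, X.IsSubcomodule N) →
    DirectedOn (· ≤ ·) F → (∀ x : X, ∃ N ∈ F, x ∈ N) → ⊤ ∈ F

/-- The class of all `L` with `Hom_C(X, L) = 0`. -/
def TorsionFree (X L : RComod A C) : Prop := ∀ f ∈ Hom X L, f = 0

/-- The class of all `M` with `Hom_C(M, L) = 0` for every `L` with `Hom_C(X, L) = 0`. -/
def Torsion (X M : RComod A C) : Prop :=
  ∀ L : RComod A C, TorsionFree X L → ∀ f ∈ Hom M L, f = 0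

/-- The underlying submodule of the radical of `M` associated to `X`: the sum of the images of all
colinear maps `N → M` with `N` torsion. -/
def radicalSubmodule (X M : RComod A C) : Submodule Aᵐᵒᵖ M :=
  ⨆ (N : RComod A C) (_ : Torsion X N) (f : Hom N M), LinearMap.range f.1

theorem radicalSubmodule_isSubcomodule (X M : RComod A C) :
    M.IsSubcomodule (radicalSubmodule X M) := by
  intro m hm
  set S := radicalSubmodule X M with hS
  let K : Submodule Aᵐᵒᵖ M :=
    { carrier := {m | M.coact m ∈ (BTensor.map S.subtype (LinearMap.id : C →ₗ[A] C)).range}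
      zero_mem' := ⟨0, by rw [map_zero, map_zero]⟩
      add_mem' := by
        rintro x y ⟨x', hx⟩ ⟨y', hy⟩
        exact ⟨x' + y', by rw [map_add, map_add, hx, hy]⟩
      smul_mem' := by
        rintro r x ⟨y, hy⟩
        refine ⟨r • y, ?_⟩
        rw [M.coact.map_smul, ← hy]
        change BTensor.map _ _ (BTensor.map _ _ y) = BTensor.map _ _ (BTensor.map _ _ y)
        rw [BTensor.map_map, BTensor.map_map]; rfl }
  suffices h : S ≤ K from h hm
  refine iSup_le fun N => iSup_le fun hN => iSup_le fun f => ?_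
  rintro _ ⟨n, rfl⟩
  have hle : LinearMap.range f.1 ≤ S :=
    (le_iSup (fun f : Hom N M => LinearMap.range f.1) f).trans
      ((le_iSup (fun _ : Torsion X N => ⨆ f : Hom N M, LinearMap.range f.1) hN).trans
        (le_iSup (fun N : RComod A C => ⨆ (_ : Torsion X N) (f : Hom N M), LinearMap.range f.1) N))
  refine ⟨BTensor.map (f.1.codRestrict S (fun n => hle ⟨n, rfl⟩)) LinearMap.id (N.coact n), ?_⟩
  rw [BTensor.map_map, f.2 n]; rfl

end RComod

end Comodules

/-! ### Rational pairings, the rational functor, and coinduction -/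

section Pairing

/-- The product of the left dual ring `Hom_A(C, A)`: `(f * g)(c) = ∑ f(c₁ g(c₂))`. -/
def conv {A C : Type*} [Ring A] [AddCommGroup C] [Module A C] [Module Aᵐᵒᵖ C]
    [SMulCommClass A Aᵐᵒᵖ C] [Coring A C] (f g : C →ₗ[A] A) : C →ₗ[A] A :=
  f ∘ₗ BTensor.contractL g ∘ₗ Coring.comul

/-- A right rational pairing `(C, B, ⟨-,-⟩)` over `A`: an `A`-coring `C`, a ring `B` with a ring
morphism `ι : A → B`, and a balanced bilinear form `C × B → A` such that
`b ↦ ⟨-, b⟩` is an anti-morphism of rings into the left dual of `C`, and such that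
`M ⊗_A C → Hom_A(B, M)`, `m ⊗ c ↦ [b ↦ m ⟨c, b⟩]` is injective for every right `A`-module `M`. -/
structure RationalPairing (A C B : Type u) [Ring A] [AddCommGroup C] [Module A C] [Module Aᵐᵒᵖ C]
    [SMulCommClass A Aᵐᵒᵖ C] [Coring A C] [Ring B] where
  ι : A →+* B
  /-- `β b = ⟨-, b⟩`. -/
  β : B →+ (C →ₗ[A] A)
  β_mul_right : ∀ b a c, β (b * ι a) c = β b c * a
  β_balanced : ∀ b (a : A) (c : C), β b (op a • c) = β (ι a * b) c
  β_one : β 1 = Coring.counit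
  β_mul : ∀ b b', β (b * b') = conv (β b') (β b)
  α_injective : ∀ (M : Type u) [AddCommGroup M] [Module Aᵐᵒᵖ M],
    Function.Injective fun (x : BTensor A M C) (b : B) => BTensor.contract (β b) x

namespace RationalPairing

variable {A C B : Type u} [Ring A] [AddCommGroup C] [Module A C] [Module Aᵐᵒᵖ C]
  [SMulCommClass A Aᵐᵒᵖ C] [Coring A C] [Ring B] (T : RationalPairing A C B)

theorem ext_contract {M : Type u} [AddCommGroup M] [Module Aᵐᵒᵖ M] {x y : BTensor A M C}
    (h : ∀ b, BTensor.contract (T.β b) x = BTensor.contract (T.β b) y) : x = y :=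
  T.α_injective M (funext h)

theorem contract_op_smul {M : Type u} [AddCommGroup M] [Module Aᵐᵒᵖ M] (b : B) (a : A)
    (x : BTensor A M C) :
    BTensor.contract (T.β b) (op a • x) = BTensor.contract (T.β (T.ι a * b)) x :=
  BTensor.contract_op_smul _ _ _ (fun c => T.β_balanced b a c) x

theorem contract_comul {M : Type u} [AddCommGroup M] [Module Aᵐᵒᵖ M] (b b' : B)
    (x : BTensor A M C) :
    BTensor.contract (T.β b' ∘ₗ BTensor.contractL (T.β b))
      (BTensor.map LinearMap.id Coring.comul x) = BTensor.contract (T.β (b * b')) x := by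
  rw [BTensor.contract_map, T.β_mul]; rfl

theorem contract_coact {M : Type u} [AddCommGroup M] [Module Aᵐᵒᵖ M]
    (ρ : M →ₗ[Aᵐᵒᵖ] BTensor A M C) (b b' : B) (x : BTensor A M C) :
    BTensor.contract (T.β b' ∘ₗ BTensor.contractL (T.β b))
      (BTensor.assoc (BTensor.map ρ (LinearMap.id : C →ₗ[A] C) x))
      = BTensor.contract (T.β b') (ρ (BTensor.contract (T.β b) x)) := by
  rw [← BTensor.contract_contract, BTensor.contract_map]; rfl

/-- A right linear map `ρ : M → M ⊗_A C` whose induced action of `B` is unital and associative is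
a comodule structure. -/
def mkComod (M : Type u) [AddCommGroup M] [Module Aᵐᵒᵖ M] (ρ : M →ₗ[Aᵐᵒᵖ] BTensor A M C)
    (h1 : ∀ m, BTensor.contract (T.β 1) (ρ m) = m)
    (h2 : ∀ b b' m, BTensor.contract (T.β b') (ρ (BTensor.contract (T.β b) (ρ m)))
      = BTensor.contract (T.β (b * b')) (ρ m)) : RComod A C where
  carrier := M
  coact := ρ
  counit m := by rw [← T.β_one, h1]
  coassoc m := by
    obtain ⟨y, hy⟩ := BTensor.assoc_surjective (BTensor.map LinearMap.id Coring.comul (ρ m))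
    rw [← hy]
    congr 1
    refine T.ext_contract fun b => T.ext_contract fun b' => ?_
    rw [BTensor.contract_contract, BTensor.contract_contract, hy, T.contract_coact,
      T.contract_comul, h2]

/-- A comodule `X`, regarded as a right `B`-module: `x b = ∑ x₀ ⟨x₁, b⟩`. -/
def BMod (_ : RationalPairing A C B) (X : RComod A C) : Type u := X.carrier

instance (X : RComod A C) : AddCommGroup (T.BMod X) := X.addCommGroup

theorem action_assoc (X : RComod A C) (b b' : B) (x : X) :
    BTensor.contract (T.β b') (X.coact (BTensor.contract (T.β b) (X.coact x)))
      = BTensor.contract (T.β (b * b')) (X.coact x) := by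
  rw [← T.contract_coact, X.coassoc, T.contract_comul]

theorem contract_add (X : RComod A C) (b b' : B) (x : BTensor A X C) :
    BTensor.contract (T.β (b + b')) x
      = BTensor.contract (T.β b) x + BTensor.contract (T.β b') x := by
  induction x using BTensor.induction_on with
  | h m p => simp [add_smul]
  | ha x y hx hy => simp only [map_add] at *; rw [hx, hy]; abel

theorem contract_zero (X : RComod A C) (x : BTensor A X C) :
    BTensor.contract (T.β 0) x = 0 := by
  have := T.contract_add X 0 0 x
  simpa using this

instance (X : RComod A C) : Module Bᵐᵒᵖ (T.BMod X) where
  smul b x := BTensor.contract (M := X) (T.β b.unop) (X.coact x)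
  one_smul x := by
    change BTensor.contract (M := X) (T.β 1) (X.coact x) = x
    rw [T.β_one]; exact X.counit x
  mul_smul b b' x := (T.action_assoc X b'.unop b.unop x).symm
  smul_zero b := by
    change BTensor.contract (M := X) (T.β b.unop) (X.coact 0) = 0
    rw [map_zero, map_zero]
  smul_add b x y := by
    exact (congrArg (BTensor.contract (M := X) (T.β b.unop)) (X.coact.map_add x y)).trans
      (map_add _ _ _)
  add_smul b b' x := T.contract_add X b.unop b'.unop _
  zero_smul x := T.contract_zero X _

/-- A colinear map is `B`-linear. -/
def toBLinear {X Y : RComod A C} (f : RComod.Hom X Y) : T.BMod X →ₗ[Bᵐᵒᵖ] T.BMod Y where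
  toFun := f.1
  map_add' := f.1.map_add
  map_smul' b x := by
    change f.1 (BTensor.contract (T.β b.unop) (X.coact x))
      = BTensor.contract (T.β b.unop) (Y.coact (f.1 x))
    rw [f.2 x, BTensor.contract_map]; rfl

/-! #### The rational functor -/

section Rat

variable (M : Type u) [AddCommGroup M] [Module Bᵐᵒᵖ M]

/-- The rational elements of a right `B`-module `M`: those `m` for which there are finitely many
`cᵢ` in `C` and `mᵢ` in `M` with `m b = ∑ᵢ mᵢ ⟨cᵢ, b⟩` for all `b`. -/
def Rat : Submodule Bᵐᵒᵖ M where
  carrier := {m | ∃ (n : ℕ) (c : Fin n → C) (x : Fin n → M),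
    ∀ b : B, op b • m = ∑ i, op (T.ι (T.β b (c i))) • x i}
  zero_mem' := ⟨0, Fin.elim0, Fin.elim0, fun b => by simp⟩
  add_mem' := by
    rintro m m' ⟨n, c, x, h⟩ ⟨n', c', x', h'⟩
    refine ⟨n + n', Fin.append c c', Fin.append x x', fun b => ?_⟩
    simp [Fin.sum_univ_add, h, h']
  smul_mem' := by
    rintro b' m ⟨n, c, x, h⟩
    refine ⟨n, fun i => BTensor.contract (T.β b'.unop) (Coring.comul (c i)), x, fun b => ?_⟩
    have := h (b'.unop * b)
    rw [op_mul, op_unop, mul_smul] at this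
    rw [this, T.β_mul]; rfl

variable {M} in
/-- The action of the rational functor on morphisms. -/
def ratMap {N : Type u} [AddCommGroup N] [Module Bᵐᵒᵖ N] (f : M →ₗ[Bᵐᵒᵖ] N) :
    T.Rat M →ₗ[Bᵐᵒᵖ] T.Rat N :=
  f.restrict (by
    rintro m ⟨n, c, x, h⟩
    refine ⟨n, c, fun i => f (x i), fun b => ?_⟩
    rw [← map_smul, h]; simp)

/-- The rational functor is exact: it preserves short exact sequences. -/
def RatExact : Prop :=
  ∀ (K M N : Type u) [AddCommGroup K] [AddCommGroup M] [AddCommGroup N]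
    [Module Bᵐᵒᵖ K] [Module Bᵐᵒᵖ M] [Module Bᵐᵒᵖ N] (f : K →ₗ[Bᵐᵒᵖ] M) (g : M →ₗ[Bᵐᵒᵖ] N),
    Function.Injective f → Function.Exact f g → Function.Surjective g →
      Function.Injective (T.ratMap f) ∧ Function.Exact (T.ratMap f) (T.ratMap g) ∧
        Function.Surjective (T.ratMap g)

/-- The right `A`-module structure of `Rat M`, by restriction along `ι`. -/
abbrev ratModule : Module Aᵐᵒᵖ (T.Rat M) := Module.compHom (T.Rat M) T.ι.op

theorem exists_ratCoact (m : T.Rat M) :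
    letI := T.ratModule M
    ∃ y : BTensor A (T.Rat M) C, ∀ b, BTensor.contract (T.β b) y = op b • m := by
  let _ := T.ratModule M
  let _ : Module Aᵐᵒᵖ M := Module.compHom M T.ι.op
  let R : Submodule Aᵐᵒᵖ M :=
    { carrier := T.Rat M
      zero_mem' := zero_mem _
      add_mem' := fun hx hy => add_mem hx hy
      smul_mem' := fun r x hx => (T.Rat M).smul_mem (T.ι.op r) hx }
  obtain ⟨n, c, x, h⟩ := m.2
  have hx : ∀ b, BTensor.contract (T.β b) (∑ i, BTensor.tmul A (x i) (c i)) = op b • m.1 := by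
    intro b
    rw [map_sum, h b]; rfl
  have hr : ∑ i, BTensor.tmul A (x i) (c i)
      ∈ (BTensor.map R.subtype (LinearMap.id : C →ₗ[A] C)).range := by
    apply BTensor.mem_range_of_map_mkQ_eq_zero
    refine T.ext_contract fun b => ?_
    rw [BTensor.contract_map, map_zero, LinearMap.comp_id, hx]
    exact (Submodule.Quotient.mk_eq_zero R).2 ((T.Rat M).smul_mem (op b) m.2)
  obtain ⟨y, hy⟩ := hr
  refine ⟨(y : BTensor A R C), fun b => Subtype.ext ?_⟩
  have := hx b
  rw [← hy, BTensor.contract_map] at this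
  exact this

/-- The coaction of `Rat M`: `ρ(m) = ∑ mᵢ ⊗ cᵢ` for rational parameters of `m` in `Rat M`. -/
def ratCoact :
    letI := T.ratModule M
    T.Rat M →ₗ[Aᵐᵒᵖ] BTensor A (T.Rat M) C :=
  letI := T.ratModule M
  { toFun := fun m => (T.exists_ratCoact M m).choose
    map_add' := fun m m' => T.ext_contract fun b => by
      rw [map_add, (T.exists_ratCoact M _).choose_spec, (T.exists_ratCoact M _).choose_spec,
        (T.exists_ratCoact M _).choose_spec, smul_add]
    map_smul' := fun r m => T.ext_contract fun b => by
      rw [RingHom.id_apply, ← op_unop r, T.contract_op_smul,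
        (T.exists_ratCoact M _).choose_spec, (T.exists_ratCoact M _).choose_spec,
        op_mul, mul_smul]
      rfl }

theorem contract_ratCoact (b : B) (m : T.Rat M) :
    letI := T.ratModule M
    BTensor.contract (T.β b) (T.ratCoact M m) = op b • m :=
  letI := T.ratModule M
  (T.exists_ratCoact M m).choose_spec b

/-- The rational functor on objects: `Rat M` as a right `C`-comodule. -/
def ratComod : RComod A C :=
  letI := T.ratModule M
  T.mkComod (T.Rat M) (T.ratCoact M)
    (fun m => by rw [contract_ratCoact, op_one, one_smul])
    (fun b b' m => by
      rw [contract_ratCoact, contract_ratCoact, contract_ratCoact, op_mul, mul_smul])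

end Rat

/-! #### Subcomodules as comodules -/

/-- `N ⊗_A C → M ⊗_A C` is injective for a submodule `N` of `M`. -/
theorem map_subtype_injective (T : RationalPairing A C B) {M : Type u} [AddCommGroup M] [Module Aᵐᵒᵖ M]
    (N : Submodule Aᵐᵒᵖ M) :
    Function.Injective (BTensor.map N.subtype (LinearMap.id : C →ₗ[A] C)) := by
  intro x y hxy
  refine T.ext_contract fun b => N.injective_subtype ?_
  have := congrArg (BTensor.contract (T.β b)) hxy
  rwa [BTensor.contract_map, BTensor.contract_map] at this

/-- The coaction of a subcomodule, by restriction. -/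
def subCoact {X : RComod A C} {N : Submodule Aᵐᵒᵖ X} (hN : X.IsSubcomodule N) :
    N →ₗ[Aᵐᵒᵖ] BTensor A N C where
  toFun n := (hN n.1 n.2).choose
  map_add' n n' := T.map_subtype_injective N (by
    rw [map_add, (hN _ (n + n').2).choose_spec, (hN _ n.2).choose_spec, (hN _ n'.2).choose_spec,
      ← map_add]; rfl)
  map_smul' r n := T.map_subtype_injective N (by
    rw [(hN _ (r • n).2).choose_spec, RingHom.id_apply]
    have h := (hN n.1 n.2).choose_spec
    set y := (hN n.1 n.2).choose
    change X.coact (r • n.1) = BTensor.map _ _ (BTensor.map _ _ y)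
    rw [map_smul, ← h, BTensor.map_map]
    change BTensor.map _ _ (BTensor.map _ _ y) = _
    rw [BTensor.map_map]; rfl)

theorem map_subCoact {X : RComod A C} {N : Submodule Aᵐᵒᵖ X} (hN : X.IsSubcomodule N) (n : N) :
    BTensor.map N.subtype (LinearMap.id : C →ₗ[A] C) (T.subCoact hN n) = X.coact n :=
  (hN n.1 n.2).choose_spec

theorem contract_subCoact {X : RComod A C} {N : Submodule Aᵐᵒᵖ X} (hN : X.IsSubcomodule N)
    (b : B) (n : N) :
    ((BTensor.contract (T.β b) (T.subCoact hN n) : N) : X) = BTensor.contract (T.β b) (X.coact n) := by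
  rw [← T.map_subCoact hN, BTensor.contract_map]; rfl

/-- A subcomodule, as a comodule. -/
def subComod {X : RComod A C} {N : Submodule Aᵐᵒᵖ X} (hN : X.IsSubcomodule N) : RComod A C :=
  T.mkComod N (T.subCoact hN)
    (fun n => Subtype.ext (by rw [T.contract_subCoact, T.β_one, X.counit]))
    (fun b b' n => Subtype.ext (by
      rw [T.contract_subCoact, T.contract_subCoact, T.contract_subCoact, T.action_assoc]))

/-- The radical of `M` associated to `X`, as a comodule. -/
def radical (X M : RComod A C) : RComod A C :=
  T.subComod (RComod.radicalSubmodule_isSubcomodule X M)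

/-! #### The coinduction functor -/

/-- The right dual `X^⋆ = Hom_B(X, B)`; it is a left `B`-module by `(b u)(x) = b u(x)`. -/
abbrev Dual (X : RComod A C) : Type u := T.BMod X →ₗ[Bᵐᵒᵖ] B

/-- `X^⋆` is a right `End_C(X)`-module: `u t = u ∘ t`. -/
instance (X : RComod A C) : Module (X.EndRing)ᵐᵒᵖ (T.Dual X) where
  smul t u := u ∘ₗ T.toBLinear (X := X) (Y := X) ⟨t.unop.1, RComod.mem_endRing t.unop⟩
  one_smul _ := rfl
  mul_smul _ _ _ := rfl
  smul_zero _ := rfl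
  smul_add _ _ _ := rfl
  add_smul _ _ u := LinearMap.ext fun _ => u.map_add _ _
  zero_smul u := LinearMap.ext fun _ => u.map_zero

instance (X : RComod A C) : SMulCommClass B (X.EndRing)ᵐᵒᵖ (T.Dual X) where
  smul_comm _ _ _ := rfl

/-- `Hom_{End_C(X)}(X^⋆, Y)`, for a right `End_C(X)`-module `Y`. -/
def DualHom (X : RComod A C) (Y : Type u) [AddCommGroup Y] [Module (X.EndRing)ᵐᵒᵖ Y] : Type u :=
  T.Dual X →ₗ[(X.EndRing)ᵐᵒᵖ] Y

section Coind

variable (X : RComod A C) (Y : Type u) [AddCommGroup Y] [Module (X.EndRing)ᵐᵒᵖ Y]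

instance : AddCommGroup (T.DualHom X Y) :=
  inferInstanceAs (AddCommGroup (T.Dual X →ₗ[(X.EndRing)ᵐᵒᵖ] Y))

/-- `Hom_{End_C(X)}(X^⋆, Y)` is a right `B`-module: `(φ b)(u) = φ(b u)`. -/
instance : Module Bᵐᵒᵖ (T.DualHom X Y) where
  smul b φ :=
    { toFun := fun u => φ.toFun (b.unop • u)
      map_add' := fun u v => by rw [smul_add]; exact φ.map_add' _ _
      map_smul' := fun t u => by rw [smul_comm]; exact φ.map_smul' _ _ }
  one_smul φ := LinearMap.ext fun u => congrArg φ.toFun (one_smul B u)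
  mul_smul b b' φ := LinearMap.ext fun u => congrArg φ.toFun (mul_smul b'.unop b.unop u)
  smul_zero _ := rfl
  smul_add _ _ _ := rfl
  add_smul b b' φ := LinearMap.ext fun u =>
    (congrArg φ.toFun (add_smul b.unop b'.unop u)).trans (φ.map_add' _ _)
  zero_smul φ := LinearMap.ext fun u =>
    (congrArg φ.toFun (zero_smul B u)).trans (LinearMap.map_zero φ)

/-- The coinduction functor on objects: `Coind_X(Y) = Rat(Hom_{End_C(X)}(X^⋆, Y))`. -/
def coind : RComod A C := T.ratComod (T.DualHom X Y)

end Coind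

end RationalPairing

end Pairing

/-! ### Isomorphism classes -/

section Classes

variable {A C : Type u} [Ring A] [AddCommGroup C] [Module A C] [Module Aᵐᵒᵖ C]
  [SMulCommClass A Aᵐᵒᵖ C] [Coring A C]

/-- The simple right comodules `S` with `Hom_C(X, S) ≠ 0`. -/
def SimpleComod (X : RComod A C) : Type (u + 1) :=
  {S : RComod A C // S.IsSimple ∧ ∃ f : RComod.Hom X S, f ≠ 0}

instance simpleComodSetoid (X : RComod A C) : Setoid (SimpleComod X) where
  r S S' := RComod.IsIso S.1 S'.1
  iseqv := RComod.isIso_equivalence.comap Subtype.val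

/-- Isomorphism classes of simple right comodules `S` with `Hom_C(X, S) ≠ 0`. -/
def SimpleComodClasses (X : RComod A C) : Type (u + 1) := Quotient (simpleComodSetoid X)

/-- The class `[S]`. -/
def SimpleComodClasses.mk {X : RComod A C} (S : RComod A C)
    (hS : S.IsSimple ∧ ∃ f : RComod.Hom X S, f ≠ 0) : SimpleComodClasses X :=
  Quotient.mk (simpleComodSetoid X) ⟨S, hS⟩

end Classes

/-- The simple right `R`-modules. -/
def SimpleRightModule (R : Type u) [Ring R] : Type (u + 1) :=
  {Y : ModuleCat.{u} Rᵐᵒᵖ // IsSimpleModule Rᵐᵒᵖ Y}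

instance simpleRightModuleSetoid (R : Type u) [Ring R] : Setoid (SimpleRightModule R) where
  r Y Y' := Nonempty (Y.1 ≃ₗ[Rᵐᵒᵖ] Y'.1)
  iseqv :=
    { refl := fun _ => ⟨LinearEquiv.refl _ _⟩
      symm := fun ⟨e⟩ => ⟨e.symm⟩
      trans := fun ⟨e⟩ ⟨e'⟩ => ⟨e.trans e'⟩ }

/-- Isomorphism classes of simple right `R`-modules. -/
def SimpleRightModuleClasses (R : Type u) [Ring R] : Type (u + 1) :=
  Quotient (simpleRightModuleSetoid R)

/-- The class `[Y]`. -/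
def SimpleRightModuleClasses.mk {R : Type u} [Ring R] (Y : Type u) [AddCommGroup Y]
    [Module Rᵐᵒᵖ Y] (hY : IsSimpleModule Rᵐᵒᵖ Y) : SimpleRightModuleClasses R :=
  Quotient.mk (simpleRightModuleSetoid R) ⟨ModuleCat.of Rᵐᵒᵖ Y, hY⟩

end Corings

end

/-!
For a projective comodule `X`, Schur-type arguments show that `Hom_C(X, -)` is well defined and
injective on isomorphism classes of simple comodules `S` with `Hom_C(X, S) ≠ 0`. A nonzero
`f : X → S` is surjective, so every `g : X → S` lifts to `g = f t`; hence `Hom_C(X, S)` is simple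
(`isSimpleModule_hom`). If `f : X → S` and `f' : X → S'` correspond under an isomorphism of the Hom
modules and `f'` does not vanish on `ker f`, then `f'` lifts to a map `t : X → ker f`, and
`f t = 0` while `f' t = f' ≠ 0`. So `f` and `f'` have the same kernel and `S ≃ S'`
(`isIso_of_hom_equiv`).

Surjectivity uses the pairing. Comodules are rational `B`-modules, colinear maps are `B`-linear
maps, and `Rat` is right adjoint to the inclusion of comodules in `B`-modules (`toRat`). Exactness
of `Rat` therefore makes `X` finitely generated projective over `B`, with a dual basis `eᵢ, uᵢ`
(`exists_dualBasis`). Through the dual basis, `Y ≃ Hom_C(X, Coind_X(Y))`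
(`toHomCoind_bijective`), and a subcomodule `N` of `Coind_X(Y)` with `Hom_C(X, N) = 0` is zero
(`eq_bot_of_forall_hom_coind_eq_zero`). Let `R` be the radical of `Coind_X(Y)`, with `Y` simple.
Since `X` is torsion, `Hom_C(X, R) ≃ Y`. If `N` is a nonzero subcomodule of `R`, then the
nonzero module `Hom_C(X, N)` is all of `Hom_C(X, R)`, so `R / N` is torsion-free by projectivity of `X`; as `R` is
torsion, `N = R`. Hence `R` is simple and is a preimage of `Y` (`isSimple_radical_coind`).
-/

namespace Corings

noncomputable section

variable {A C : Type u} [Ring A] [AddCommGroup C] [Module A C] [Module Aᵐᵒᵖ C]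
  [SMulCommClass A Aᵐᵒᵖ C] [Coring A C]

/-! ### Isomorphisms and torsion comodules -/

namespace RComod

/-- Surjective colinear maps with the same kernel have isomorphic targets. -/
theorem isIso_of_ker_eq {X S S' : RComod A C} (f : Hom X S) (f' : Hom X S')
    (hf : Function.Surjective f.1) (hf' : Function.Surjective f'.1)
    (h : LinearMap.ker f.1 = LinearMap.ker f'.1) : IsIso S S' := by
  let e : S ≃ₗ[Aᵐᵒᵖ] S' := (f.1.quotKerEquivOfSurjective hf).symm ≪≫ₗ
    Submodule.quotEquivOfEq _ _ h ≪≫ₗ f'.1.quotKerEquivOfSurjective hf'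
  have he : ∀ x, e (f.1 x) = f'.1 x := by
    intro x
    have : (f.1.quotKerEquivOfSurjective hf).symm (f.1 x) = (LinearMap.ker f.1).mkQ x := by
      rw [LinearEquiv.symm_apply_eq]; rfl
    simp only [e, LinearEquiv.trans_apply, this]
    rfl
  refine ⟨e, fun s => ?_⟩
  obtain ⟨x, rfl⟩ := hf s
  have hcomp : (e : S →ₗ[Aᵐᵒᵖ] S') ∘ₗ f.1 = f'.1 := LinearMap.ext he
  rw [LinearEquiv.coe_coe, he, f'.2 x, f.2 x, BTensor.map_map, hcomp, LinearMap.id_comp]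

/-- The isomorphism `Hom_C(X, S) ≃ Hom_C(X, S')` of right `End_C(X)`-modules given by an
isomorphism `S ≃ S'`. -/
theorem IsIso.nonempty_hom_equiv {X S S' : RComod A C} (h : IsIso S S') :
    Nonempty (Hom X S ≃ₗ[(X.EndRing)ᵐᵒᵖ] Hom X S') := by
  obtain ⟨e, he⟩ := h
  let φ : Hom X S →ₗ[(X.EndRing)ᵐᵒᵖ] Hom X S' :=
    { toFun := fun f => ⟨(e : S →ₗ[Aᵐᵒᵖ] S') ∘ₗ f.1, comp_mem he f.2⟩
      map_add' := fun f g => Subtype.ext (LinearMap.comp_add _ _ _)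
      map_smul' := fun _ _ => rfl }
  have he' : (e.symm : S' →ₗ[Aᵐᵒᵖ] S) ∈ Hom S' S := by
    intro y
    obtain ⟨x, rfl⟩ := e.surjective y
    have h := he x
    simp only [LinearEquiv.coe_coe] at h ⊢
    rw [h, BTensor.map_map, LinearEquiv.symm_apply_apply, LinearEquiv.symm_comp,
      LinearMap.id_comp, BTensor.map_id]
  refine ⟨LinearEquiv.ofBijective φ ⟨fun f g hfg => Subtype.ext (LinearMap.ext fun x => ?_),
    fun g => ⟨⟨(e.symm : S' →ₗ[Aᵐᵒᵖ] S) ∘ₗ g.1, comp_mem he' g.2⟩,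
      Subtype.ext (LinearMap.ext fun x => e.apply_symm_apply _)⟩⟩⟩
  exact e.injective (LinearMap.congr_fun (congrArg Subtype.val hfg) x)

theorem range_le_radicalSubmodule {X M N : RComod A C} (hN : Torsion X N) (f : Hom N M) :
    LinearMap.range f.1 ≤ radicalSubmodule X M :=
  (le_iSup (fun f : Hom N M => LinearMap.range f.1) f).trans
    ((le_iSup (fun _ : Torsion X N => ⨆ f : Hom N M, LinearMap.range f.1) hN).trans
      (le_iSup (fun N : RComod A C => ⨆ (_ : Torsion X N) (f : Hom N M), LinearMap.range f.1) N))

theorem torsion_self (X : RComod A C) : Torsion X X := fun _ hL f hf => hL f hf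

end RComod

namespace RationalPairing

open RComod

variable {B : Type u} [Ring B] (T : RationalPairing A C B)

/-! ### Comodules as rational `B`-modules -/

theorem op_smul_bMod (X : RComod A C) (b : B) (x : T.BMod X) :
    op b • x = BTensor.contract (M := X) (T.β b) (X.coact x) := rfl

/-- Restricting the `B`-action on a comodule along `ι` recovers the given `A`-action. -/
theorem op_ι_smul (X : RComod A C) (a : A) (x : X) :
    (op (T.ι a) • (show T.BMod X from x) : T.BMod X) = (op a • x : X) := by
  rw [op_smul_bMod]
  have h := T.contract_op_smul (M := X) 1 a (X.coact x)
  rw [mul_one] at h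
  rw [← h, ← map_smul, T.β_one]
  exact X.counit _

variable {T} in
/-- A `B`-linear map between comodules is colinear. -/
def ofBLinear {X Y : RComod A C} (f : T.BMod X →ₗ[Bᵐᵒᵖ] T.BMod Y) : Hom X Y :=
  ⟨{ toFun := f
     map_add' := f.map_add
     map_smul' := fun r x => by
      have h := f.map_smul (op (T.ι r.unop)) x
      rw [T.op_ι_smul X r.unop x, T.op_ι_smul Y r.unop (f x)] at h
      exact h },
   fun x => T.ext_contract fun b => by
    rw [BTensor.contract_map]
    exact (f.map_smul (op b) x).symm⟩

/-- Subcomodules are the submodules that are stable under the action of `B`. -/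
theorem isSubcomodule_iff {X : RComod A C} {N : Submodule Aᵐᵒᵖ X} :
    X.IsSubcomodule N ↔ ∀ n ∈ N, ∀ b : B, BTensor.contract (T.β b) (X.coact n) ∈ N := by
  refine ⟨fun h n hn b => ?_, fun h n hn => ?_⟩
  · obtain ⟨y, hy⟩ := h n hn
    rw [← hy, BTensor.contract_map]
    exact Subtype.property _
  · refine BTensor.mem_range_of_map_mkQ_eq_zero N _ (T.ext_contract fun b => ?_)
    rw [BTensor.contract_map, map_zero]
    exact (Submodule.Quotient.mk_eq_zero N).2 (h n hn b)

/-- A subcomodule, as a `B`-submodule. -/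
def toBSubmodule {X : RComod A C} {N : Submodule Aᵐᵒᵖ X} (hN : X.IsSubcomodule N) :
    Submodule Bᵐᵒᵖ (T.BMod X) where
  carrier := (N : Set X)
  zero_mem' := N.zero_mem
  add_mem' := N.add_mem
  smul_mem' b x hx := T.isSubcomodule_iff.1 hN x hx b.unop

/-- A `B`-submodule of a comodule, as an `A`-submodule. -/
def ofBSubmodule {X : RComod A C} (N : Submodule Bᵐᵒᵖ (T.BMod X)) : Submodule Aᵐᵒᵖ X where
  carrier := (N : Set (T.BMod X))
  zero_mem' := N.zero_mem
  add_mem' := N.add_mem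
  smul_mem' r x hx := by
    have h := N.smul_mem (op (T.ι r.unop)) hx
    rw [T.op_ι_smul X r.unop x] at h
    exact h

theorem mem_ofBSubmodule {X : RComod A C} {N : Submodule Bᵐᵒᵖ (T.BMod X)} {x : X} :
    x ∈ T.ofBSubmodule N ↔ (show T.BMod X from x) ∈ N := Iff.rfl

theorem ofBSubmodule_isSubcomodule {X : RComod A C} (N : Submodule Bᵐᵒᵖ (T.BMod X)) :
    X.IsSubcomodule (T.ofBSubmodule N) :=
  T.isSubcomodule_iff.2 fun _ hn b =>
    T.mem_ofBSubmodule.2 (N.smul_mem (op b) (T.mem_ofBSubmodule.1 hn))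

theorem ker_isSubcomodule (T : RationalPairing A C B) {X Y : RComod A C} (f : Hom X Y) :
    X.IsSubcomodule (LinearMap.ker f.1) :=
  T.ofBSubmodule_isSubcomodule (LinearMap.ker (T.toBLinear f))

theorem map_isSubcomodule (T : RationalPairing A C B) {X Y : RComod A C} (f : Hom X Y)
    {N : Submodule Aᵐᵒᵖ X}
    (hN : X.IsSubcomodule N) : Y.IsSubcomodule (N.map f.1) :=
  T.ofBSubmodule_isSubcomodule ((T.toBSubmodule hN).map (T.toBLinear f))

/-- The inclusion of a subcomodule. -/
def subtypeHom {X : RComod A C} {N : Submodule Aᵐᵒᵖ X} (hN : X.IsSubcomodule N) :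
    Hom (T.subComod hN) X :=
  ⟨N.subtype, fun n => (T.map_subCoact hN n).symm⟩

/-- A colinear map with values in a subcomodule, as a colinear map to that subcomodule. -/
def codRestrictHom {X Y : RComod A C} {N : Submodule Aᵐᵒᵖ Y} (hN : Y.IsSubcomodule N)
    (f : Hom X Y) (h : ∀ x, f.1 x ∈ N) : Hom X (T.subComod hN) :=
  ⟨f.1.codRestrict N h, fun x => T.map_subtype_injective N (by
    refine (T.map_subCoact hN (f.1.codRestrict N h x)).trans ?_
    rw [LinearMap.codRestrict_apply, f.2 x]
    exact (BTensor.map_map (f.1.codRestrict N h) LinearMap.id N.subtype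
      (LinearMap.id : C →ₗ[A] C) (X.coact x)).symm)⟩

/-- Every element of a comodule is rational. -/
theorem mem_rat_bMod (X : RComod A C) (x : T.BMod X) : x ∈ T.Rat (T.BMod X) := by
  have key : ∀ y : BTensor A X C, ∃ (n : ℕ) (c : Fin n → C) (z : Fin n → X),
      ∀ b : B, BTensor.contract (T.β b) y = ∑ i, op (T.β b (c i)) • z i := by
    intro y
    induction y using BTensor.induction_on with
    | h m p => exact ⟨1, fun _ => p, fun _ => m, fun b => by simp⟩
    | ha y y' h h' =>
      obtain ⟨n, c, z, h⟩ := h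
      obtain ⟨n', c', z', h'⟩ := h'
      refine ⟨n + n', Fin.append c c', Fin.append z z', fun b => ?_⟩
      simp [Fin.sum_univ_add, h, h']
  obtain ⟨n, c, z, h⟩ := key (X.coact x)
  refine ⟨n, c, z, fun b => (h b).trans (Finset.sum_congr rfl fun i _ => ?_)⟩
  exact (T.op_ι_smul X _ (z i)).symm

section ToRat

variable {M : Type u} [AddCommGroup M] [Module Bᵐᵒᵖ M]

variable (M) in
/-- The inclusion of `Rat M` in `M`, on the underlying `B`-module of the comodule `Rat M`. -/
def ratInclusion : T.BMod (T.ratComod M) →ₗ[Bᵐᵒᵖ] M where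
  toFun := fun m => (show T.Rat M from m).1
  map_add' _ _ := rfl
  map_smul' b m := congrArg Subtype.val (T.contract_ratCoact M b.unop m)

theorem ratInclusion_injective : Function.Injective (T.ratInclusion M) := Subtype.val_injective

/-- `Rat` is right adjoint to the inclusion of comodules in `B`-modules: a `B`-linear map from a
comodule to `M` corestricts to a colinear map to `Rat M`. -/
def toRat {X : RComod A C} (f : T.BMod X →ₗ[Bᵐᵒᵖ] M) : Hom X (T.ratComod M) :=
  ofBLinear
    { toFun := fun x => (show T.BMod (T.ratComod M) from
        T.ratMap f ⟨x, T.mem_rat_bMod X x⟩)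
      map_add' := fun x y => T.ratInclusion_injective (f.map_add x y)
      map_smul' := fun b x => T.ratInclusion_injective (by
        rw [map_smul]; exact f.map_smul b x) }

end ToRat

/-! ### The dual basis -/

variable {X : RComod A C}

/-- The map `x ↦ m u(x)`, for an element `m` of a right `B`-module and `u : X → B`. -/
def rankOne {M : Type u} [AddCommGroup M] [Module Bᵐᵒᵖ M] (m : M) (u : T.Dual X) :
    T.BMod X →ₗ[Bᵐᵒᵖ] M where
  toFun x := op (u x) • m
  map_add' x y := by rw [map_add, op_add, add_smul]
  map_smul' b x := by rw [map_smul, RingHom.id_apply, ← mul_smul]; rfl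

/-- A finitely generated comodule is finitely generated over `B`: it is the directed union of its
finitely generated `B`-submodules. -/
theorem finite_bMod (hfg : X.IsFinGen) : Module.Finite Bᵐᵒᵖ (T.BMod X) := by
  obtain ⟨N, hN, h⟩ := hfg {N | ∃ N' : Submodule Bᵐᵒᵖ (T.BMod X), N'.FG ∧ T.ofBSubmodule N' = N}
    ⟨_, ⊥, Submodule.fg_bot, rfl⟩
    (by rintro _ ⟨N, -, rfl⟩; exact T.ofBSubmodule_isSubcomodule N)
    (by
      rintro _ ⟨N, hN, rfl⟩ _ ⟨N', hN', rfl⟩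
      exact ⟨_, ⟨N ⊔ N', hN.sup hN', rfl⟩, fun x hx => (le_sup_left : N ≤ N ⊔ N') hx,
        fun x hx => (le_sup_right : N' ≤ N ⊔ N') hx⟩)
    (fun x => ⟨_, ⟨Bᵐᵒᵖ ∙ (show T.BMod X from x), Submodule.fg_span_singleton _, rfl⟩,
      T.mem_ofBSubmodule.2 (Submodule.mem_span_singleton_self _)⟩)
  have hN' : N = ⊤ := top_unique fun x _ => by
    have hx : (show X from x) ∈ T.ofBSubmodule N := h ▸ Submodule.mem_top
    exact T.mem_ofBSubmodule.1 hx
  exact ⟨hN' ▸ hN⟩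

/-- If `Rat` is exact, a finitely generated projective comodule has a finite dual basis over `B`:
a surjection `B ^ n → X` induces a surjection `Rat (B ^ n) → X` of comodules, which splits. -/
theorem exists_dualBasis (hT : T.RatExact) (hfg : X.IsFinGen) (hproj : X.IsProjective) :
    ∃ (n : ℕ) (e : Fin n → T.BMod X) (u : Fin n → T.Dual X),
      ∀ x, ∑ i, op (u i x) • e i = x := by
  obtain ⟨n, e, he⟩ := Submodule.fg_iff_exists_fin_generating_family.1
    (T.finite_bMod hfg).fg_top
  let p : (Fin n → B) →ₗ[Bᵐᵒᵖ] T.BMod X :=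
    { toFun := fun v => ∑ i, op (v i) • e i
      map_add' := fun v w => by simp [add_smul, Finset.sum_add_distrib]
      map_smul' := fun b v => by
        rw [Finset.smul_sum]
        exact Finset.sum_congr rfl fun i _ => mul_smul b (op (v i)) (e i) }
  have hp : Function.Surjective p := by
    rw [← LinearMap.range_eq_top, ← top_le_iff, ← he, Submodule.span_le]
    rintro _ ⟨i, rfl⟩
    refine ⟨Pi.single i 1, ?_⟩
    change ∑ j, op ((Pi.single i 1 : Fin n → B) j) • e j = e i
    rw [Finset.sum_eq_single i (fun j _ hj => by simp [hj]) (by simp)]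
    simp
  have hs := (hT _ _ _ (LinearMap.ker p).subtype p (Submodule.subtype_injective _)
    (LinearMap.exact_subtype_ker_map p) hp).2.2
  have hsurj : Function.Surjective
      (ofBLinear (T := T) (Y := X) (p ∘ₗ T.ratInclusion (Fin n → B))).1 := by
    intro x
    obtain ⟨v, hv⟩ := hs ⟨x, T.mem_rat_bMod X x⟩
    exact ⟨v, congrArg Subtype.val hv⟩
  obtain ⟨g, hg⟩ := hproj _ _ (ofBLinear (T := T) (p ∘ₗ T.ratInclusion (Fin n → B)))
    ⟨LinearMap.id, id_mem X⟩ hsurj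
  refine ⟨n, e, fun i => LinearMap.proj i ∘ₗ T.ratInclusion (Fin n → B) ∘ₗ T.toBLinear g,
    fun x => ?_⟩
  exact LinearMap.congr_fun hg x

/-! ### Coinduction -/

section Coind

variable {Y : Type u} [AddCommGroup Y] [Module (X.EndRing)ᵐᵒᵖ Y]

/-- The endomorphism `x' ↦ x u(x')` of `X`. -/
def rankOneEnd (x : T.BMod X) (u : T.Dual X) : X.EndRing :=
  ⟨(ofBLinear (T.rankOne x u)).1, (ofBLinear (T.rankOne x u)).2⟩

theorem rankOneEnd_add_left (x x' : T.BMod X) (u : T.Dual X) :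
    T.rankOneEnd (x + x') u = T.rankOneEnd x u + T.rankOneEnd x' u :=
  Subtype.ext (LinearMap.ext fun z => smul_add (A := T.BMod X) (op (u z)) x x')

theorem rankOneEnd_add_right (x : T.BMod X) (u u' : T.Dual X) :
    T.rankOneEnd x (u + u') = T.rankOneEnd x u + T.rankOneEnd x u' :=
  Subtype.ext (LinearMap.ext fun z => add_smul (M := T.BMod X) (op (u z)) (op (u' z)) x)

theorem rankOneEnd_smul_right (x : T.BMod X) (u : T.Dual X) (t : X.EndRing) :
    T.rankOneEnd x (op t • u) = T.rankOneEnd x u * t := rfl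

theorem rankOneEnd_smul_left (x : T.BMod X) (u : T.Dual X) (b : B) :
    T.rankOneEnd (op b • x) u = T.rankOneEnd x (b • u) :=
  Subtype.ext (LinearMap.ext fun z => (mul_smul (op (u z)) (op b) x).symm)

theorem mul_rankOneEnd (x : T.BMod X) (u : T.Dual X) (t : X.EndRing) :
    t * T.rankOneEnd x u = T.rankOneEnd (show T.BMod X from t.1 x) u :=
  Subtype.ext (LinearMap.ext fun z =>
    (T.toBLinear (X := X) (Y := X) ⟨t.1, mem_endRing t⟩).map_smul (op (u z)) x)

theorem dual_comp_rankOneEnd (x : T.BMod X) (u v : T.Dual X) :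
    op (T.rankOneEnd x u) • v = v x • u :=
  LinearMap.ext fun z => v.map_smul (op (u z)) x

variable (X) in
/-- The map `X → Hom_{End_C(X)}(X^⋆, Y)`, `x ↦ (u ↦ y (x u(-)))`. -/
def toDualHom (y : Y) : T.BMod X →ₗ[Bᵐᵒᵖ] T.DualHom X Y where
  toFun x := (show T.Dual X →ₗ[(X.EndRing)ᵐᵒᵖ] Y from
    { toFun := fun u => op (T.rankOneEnd x u) • y
      map_add' := fun u v => by rw [rankOneEnd_add_right, op_add, add_smul]
      map_smul' := fun t u => by
        rw [RingHom.id_apply, ← mul_smul, ← op_unop t, rankOneEnd_smul_right, op_mul] })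
  map_add' x x' := LinearMap.ext fun u => by
    change op (T.rankOneEnd (x + x') u) • y
      = op (T.rankOneEnd x u) • y + op (T.rankOneEnd x' u) • y
    rw [rankOneEnd_add_left, op_add, add_smul]
  map_smul' b x := LinearMap.ext fun u =>
    congrArg (fun t : X.EndRing => op t • y) (T.rankOneEnd_smul_left x u b.unop)

variable (X Y) in
/-- The natural map `Y → Hom_C(X, Coind_X(Y))`, `y ↦ (x ↦ (u ↦ y (x u(-))))`. -/
def toHomCoind : Y →ₗ[(X.EndRing)ᵐᵒᵖ] Hom X (T.coind X Y) where
  toFun y := T.toRat (T.toDualHom X y)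
  map_add' y y' := Subtype.ext (LinearMap.ext fun x => T.ratInclusion_injective
    (LinearMap.ext fun u => smul_add (op (T.rankOneEnd x u)) y y'))
  map_smul' t y := Subtype.ext (LinearMap.ext fun x => T.ratInclusion_injective
    (LinearMap.ext fun u => (mul_smul (op (T.rankOneEnd x u)) t y).symm.trans
      (congrArg (fun s : X.EndRing => op s • y) (T.mul_rankOneEnd x u t.unop))))

/-- With a dual basis `eᵢ, uᵢ` of `X` over `B`, the inverse sends `f` to `∑ f(eᵢ)(uᵢ)`; this is the
counit at `Y` of the adjunction between `Hom_C(X, -)` and `Coind_X`. -/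
theorem toHomCoind_bijective (hT : T.RatExact) (hfg : X.IsFinGen) (hproj : X.IsProjective) :
    Function.Bijective (T.toHomCoind X Y) := by
  obtain ⟨n, e, u, h⟩ := T.exists_dualBasis hT hfg hproj
  -- The dual basis identity says that `∑ eᵢ uᵢ(-)` is the unit of `End_C(X)`.
  have hone : ∑ i, T.rankOneEnd (e i) (u i) = 1 := Subtype.ext (LinearMap.ext fun x => by
    rw [AddSubmonoidClass.coe_finsetSum, LinearMap.sum_apply]
    exact h x)
  refine ⟨(injective_iff_map_eq_zero _).2 fun y hy => ?_, fun f => ?_⟩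
  · have hz : ∀ x v, op (T.rankOneEnd x v) • y = 0 := fun x v =>
      LinearMap.congr_fun (congrArg (fun f : Hom X (T.coind X Y) =>
        T.ratInclusion (T.DualHom X Y) (f.1 x)) hy) v
    rw [← one_smul (X.EndRing)ᵐᵒᵖ y, ← op_one, ← hone, Finset.op_sum, Finset.sum_smul]
    exact Finset.sum_eq_zero fun i _ => hz _ _
  · let F : T.BMod X →ₗ[Bᵐᵒᵖ] T.DualHom X Y :=
      T.ratInclusion (T.DualHom X Y) ∘ₗ T.toBLinear f
    let ev : T.BMod X → T.Dual X → Y := fun x v => (F x).toFun v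
    have ev_smul : ∀ x v (t : X.EndRing), op t • ev x v = ev x (op t • v) :=
      fun x v t => ((F x).map_smul' (op t) v).symm
    have ev_op : ∀ x v (b : B), ev x (b • v) = ev (op b • x) v := fun x v b => by
      change _ = (F (op b • x)).toFun v
      rw [map_smul]; rfl
    have ev_sum : ∀ (x : Fin n → T.BMod X) v, ∑ i, ev (x i) v = ev (∑ i, x i) v := fun x v => by
      change _ = (F (∑ i, x i)).toFun v
      rw [map_sum]
      exact (LinearMap.sum_apply (M := T.Dual X) (M₂ := Y) Finset.univ (fun i => F (x i)) v).symm
    refine ⟨∑ i, ev (e i) (u i), Subtype.ext (LinearMap.ext fun x =>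
      T.ratInclusion_injective (LinearMap.ext fun v => ?_))⟩
    change op (T.rankOneEnd x v) • ∑ i, ev (e i) (u i) = ev x v
    rw [Finset.smul_sum]
    exact (Finset.sum_congr rfl fun i _ => (ev_smul _ _ _).trans
      ((congrArg (ev (e i)) (T.dual_comp_rankOneEnd x v (u i))).trans (ev_op _ _ _))).trans
      ((ev_sum _ v).trans (congrArg (fun z => ev z v) (h x)))

/-- A nonzero subcomodule `N` of `Coind_X(Y)` has `Hom_C(X, N) ≠ 0`: if `φ ∈ N` and all maps
`x ↦ φ u(x)` from `X` to `N` vanish, then `φ = 0` by the dual basis of `X`. -/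
theorem eq_bot_of_forall_hom_coind_eq_zero (hT : T.RatExact) (hfg : X.IsFinGen)
    (hproj : X.IsProjective) {N : Submodule Aᵐᵒᵖ (T.coind X Y)}
    (hN : (T.coind X Y).IsSubcomodule N) (h0 : ∀ f : Hom X (T.coind X Y),
      (∀ x, f.1 x ∈ N) → f = 0) : N = ⊥ := by
  obtain ⟨n, e, u, h⟩ := T.exists_dualBasis hT hfg hproj
  refine (Submodule.eq_bot_iff N).2 fun φ hφ => T.ratInclusion_injective
    (LinearMap.ext fun v => ?_)
  let ψ : T.BMod (T.coind X Y) := φ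
  let Φ : T.DualHom X Y := T.ratInclusion (T.DualHom X Y) ψ
  have hz : ∀ x w, Φ.toFun (v x • w) = 0 := fun x w => by
    have h1 := h0 (ofBLinear (T.rankOne ψ v))
      (fun x => T.isSubcomodule_iff.1 hN φ hφ _)
    have h2 : T.rankOne ψ v x = 0 :=
      LinearMap.congr_fun (congrArg Subtype.val h1) x
    have h3 : op (v x) • Φ = 0 :=
      ((T.ratInclusion (T.DualHom X Y)).map_smul (op (v x)) ψ).symm.trans
        ((congrArg (T.ratInclusion (T.DualHom X Y)) h2).trans (map_zero _))
    exact LinearMap.congr_fun h3 w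
  have hv : v = ∑ i, v (e i) • u i := LinearMap.ext fun x => by
    conv_lhs => rw [← h x, map_sum]
    rw [LinearMap.sum_apply]
    exact Finset.sum_congr rfl fun i _ => v.map_smul _ _
  change Φ.toFun v = 0
  rw [hv]
  refine (map_sum (show T.Dual X →ₗ[(X.EndRing)ᵐᵒᵖ] Y from Φ) _ _).trans ?_
  exact Finset.sum_eq_zero fun i _ => hz (e i) (u i)

end Coind

/-! ### The radical -/

/-- The radical is torsion: a map from it to a torsion-free comodule vanishes on the image of every
torsion comodule, and these images generate the radical. -/
theorem torsion_radical (X M : RComod A C) : Torsion X (T.radical X M) := by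
  intro L hL g hg
  suffices h : radicalSubmodule X M ≤
      (LinearMap.ker g).map (radicalSubmodule X M).subtype by
    refine LinearMap.ext fun m => ?_
    obtain ⟨m', hm', h'⟩ := h m.2
    have : m' = m := Subtype.ext h'
    subst this
    exact hm'
  refine iSup_le fun N => iSup_le fun hN => iSup_le fun f => ?_
  rintro _ ⟨x, rfl⟩
  let f' : Hom N (T.radical X M) := T.codRestrictHom _ f
    fun x => range_le_radicalSubmodule hN f ⟨x, rfl⟩
  exact ⟨f'.1 x, LinearMap.congr_fun (hN L hL _ (comp_mem hg f'.2)) x, rfl⟩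

/-- `Hom_C(X, r_X(M)) ≃ Hom_C(X, M)`, since `X` is torsion. -/
theorem nonempty_hom_radical_equiv (X M : RComod A C) :
    Nonempty (Hom X (T.radical X M) ≃ₗ[(X.EndRing)ᵐᵒᵖ] Hom X M) := by
  let i := T.subtypeHom (radicalSubmodule_isSubcomodule X M)
  let φ : Hom X (T.radical X M) →ₗ[(X.EndRing)ᵐᵒᵖ] Hom X M :=
    { toFun := fun f => ⟨i.1 ∘ₗ f.1, comp_mem i.2 f.2⟩
      map_add' := fun f g => Subtype.ext (LinearMap.comp_add _ _ _)
      map_smul' := fun _ _ => rfl }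
  refine ⟨LinearEquiv.ofBijective φ ⟨fun f g hfg => Subtype.ext (LinearMap.ext fun x => ?_),
    fun f => ⟨T.codRestrictHom _ f
      fun x => range_le_radicalSubmodule (torsion_self X) f ⟨x, rfl⟩, rfl⟩⟩⟩
  exact Subtype.val_injective (LinearMap.congr_fun (congrArg Subtype.val hfg) x)

/-- If `X` is projective, a torsion comodule `M` has no proper subcomodule containing the images
of all maps from `X`: the quotient is torsion-free. -/
theorem eq_top_of_range_le (T : RationalPairing A C B) (hproj : X.IsProjective)
    {M : RComod A C} (hM : Torsion X M)
    {N : Submodule Aᵐᵒᵖ M} (hN : M.IsSubcomodule N) (h : ∀ f : Hom X M, ∀ x, f.1 x ∈ N) :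
    N = ⊤ := by
  let N' := T.toBSubmodule hN
  -- The quotient of `M` by `N`: as a quotient of a rational module, `M ⧸ N'` equals its own `Rat`.
  let q : Hom M (T.ratComod (T.BMod M ⧸ N')) := T.toRat N'.mkQ
  have hq : ∀ m, q.1 m = 0 ↔ m ∈ N := fun m =>
    (map_eq_zero_iff (T.ratInclusion _) T.ratInclusion_injective (x := q.1 m)).symm.trans
      (Submodule.Quotient.mk_eq_zero N')
  have hqs : Function.Surjective q.1 := by
    rintro ⟨y, hy⟩
    obtain ⟨m, rfl⟩ := N'.mkQ_surjective y
    exact ⟨m, rfl⟩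
  have hL : TorsionFree X (T.ratComod (T.BMod M ⧸ N')) := by
    intro f hf
    obtain ⟨g, hg⟩ := hproj _ _ q ⟨f, hf⟩ hqs
    exact hg.symm.trans (LinearMap.ext fun x => (hq _).2 (h g x))
  refine top_unique fun m _ => (hq m).1 ?_
  rw [hM _ hL q.1 q.2]
  rfl

/-! ### Simple comodules and simple modules -/

theorem surjective_of_isSimple (T : RationalPairing A C B) {S : RComod A C}
    (hS : S.IsSimple) {f : Hom X S} (hf : f ≠ 0) :
    Function.Surjective f.1 := by
  rw [← LinearMap.range_eq_top, LinearMap.range_eq_map]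
  refine (hS.2 _ (T.map_isSubcomodule f (N := ⊤)
    (T.isSubcomodule_iff.2 fun _ _ _ => trivial))).resolve_left fun h => hf (Subtype.ext ?_)
  rwa [← LinearMap.range_eq_map, LinearMap.range_eq_bot] at h

/-- For `S` simple, every nonzero `f : X → S` is surjective and hence, `X` being projective,
generates `Hom_C(X, S)`. -/
theorem isSimpleModule_hom (T : RationalPairing A C B) (hproj : X.IsProjective)
    {S : RComod A C} (hS : S.IsSimple)
    (h : ∃ f : Hom X S, f ≠ 0) : IsSimpleModule (X.EndRing)ᵐᵒᵖ (Hom X S) := by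
  obtain ⟨f₀, hf₀⟩ := h
  refine isSimpleModule_iff_toSpanSingleton_surjective.2 ⟨⟨f₀, 0, hf₀⟩, fun f hf g => ?_⟩
  obtain ⟨t, ht⟩ := hproj _ _ f g (T.surjective_of_isSimple hS hf)
  exact ⟨op ⟨t.1, t.2⟩, Subtype.ext ht⟩

/-- If every endomorphism `t` of `X` with `f t = 0` has `f' t = 0`, then `ker f ≤ ker f'`;
otherwise `f'` maps `ker f` onto `S'` and lifts to a map `X → ker f`. -/
theorem ker_le_ker (T : RationalPairing A C B) (hproj : X.IsProjective)
    {S S' : RComod A C} (hS' : S'.IsSimple)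
    {f : Hom X S} {f' : Hom X S'} (hf' : f' ≠ 0)
    (h : ∀ t : X.EndRing, op t • f = 0 → op t • f' = 0) :
    LinearMap.ker f.1 ≤ LinearMap.ker f'.1 := by
  have hK := T.ker_isSubcomodule f
  rcases hS'.2 _ (T.map_isSubcomodule f' hK) with h0 | h1
  · intro x hx
    have : f'.1 x ∈ (LinearMap.ker f.1).map f'.1 := ⟨x, hx, rfl⟩
    rw [h0] at this
    exact this
  · exfalso
    let i := T.subtypeHom hK
    have hs : Function.Surjective (f'.1 ∘ₗ i.1) := fun s => by
      obtain ⟨x, hx, rfl⟩ : s ∈ (LinearMap.ker f.1).map f'.1 := h1 ▸ Submodule.mem_top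
      exact ⟨⟨x, hx⟩, rfl⟩
    obtain ⟨g, hg⟩ := hproj _ _ ⟨f'.1 ∘ₗ i.1, comp_mem f'.2 i.2⟩ f' hs
    have ht := h ⟨i.1 ∘ₗ g.1, comp_mem i.2 g.2⟩
      (Subtype.ext (LinearMap.ext fun x => (g.1 x).2))
    exact hf' ((Subtype.ext hg).symm.trans ht)

/-- A simple comodule `S` with `Hom_C(X, S) ≠ 0` is determined by `Hom_C(X, S)`: corresponding
nonzero maps `X → S` and `X → S'` have the same kernel. -/
theorem isIso_of_hom_equiv (T : RationalPairing A C B) (hproj : X.IsProjective)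
    {S S' : RComod A C} (hS : S.IsSimple)
    (hS' : S'.IsSimple) (h : ∃ f : Hom X S, f ≠ 0)
    (e : Hom X S ≃ₗ[(X.EndRing)ᵐᵒᵖ] Hom X S') : IsIso S S' := by
  obtain ⟨f, hf⟩ := h
  have hf' : e f ≠ 0 := (map_ne_zero_iff e e.injective).2 hf
  refine isIso_of_ker_eq f (e f) (T.surjective_of_isSimple hS hf)
    (T.surjective_of_isSimple hS' hf') (le_antisymm ?_ ?_)
  · exact T.ker_le_ker hproj hS' hf' fun t ht => by rw [← map_smul, ht, map_zero]
  · exact T.ker_le_ker hproj hS hf fun t ht => by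
      rwa [← map_smul, map_eq_zero_iff e e.injective] at ht

section RadicalCoind

variable (Y : Type u) [AddCommGroup Y] [Module (X.EndRing)ᵐᵒᵖ Y]

theorem nonempty_hom_radical_coind_equiv (hT : T.RatExact) (hfg : X.IsFinGen)
    (hproj : X.IsProjective) :
    Nonempty (Hom X (T.radical X (T.coind X Y)) ≃ₗ[(X.EndRing)ᵐᵒᵖ] Y) := by
  obtain ⟨e⟩ := T.nonempty_hom_radical_equiv X (T.coind X Y)
  exact ⟨e ≪≫ₗ
    (LinearEquiv.ofBijective _ (T.toHomCoind_bijective (Y := Y) hT hfg hproj)).symm⟩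

/-- A nonzero subcomodule `N` of the radical `R` of `Coind_X(Y)` has `Hom_C(X, N) ≠ 0`, hence
`Hom_C(X, N) = Hom_C(X, R)` because the latter is simple, and so `N = R` because `R` is torsion. -/
theorem isSimple_radical_coind (hT : T.RatExact) (hfg : X.IsFinGen) (hproj : X.IsProjective)
    (hY : IsSimpleModule (X.EndRing)ᵐᵒᵖ Y) :
    (T.radical X (T.coind X Y)).IsSimple ∧
      ∃ f : Hom X (T.radical X (T.coind X Y)), f ≠ 0 := by
  obtain ⟨e⟩ := T.nonempty_hom_radical_coind_equiv (X := X) Y hT hfg hproj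
  have hsimple : IsSimpleModule (X.EndRing)ᵐᵒᵖ (Hom X (T.radical X (T.coind X Y))) :=
    IsSimpleModule.congr e
  obtain ⟨f₀, hf₀⟩ : ∃ f : Hom X (T.radical X (T.coind X Y)), f ≠ 0 :=
    haveI := hsimple.nontrivial
    exists_ne 0
  refine ⟨⟨?_, fun N hN => ?_⟩, f₀, hf₀⟩
  · by_contra hn
    rw [not_nontrivial_iff_subsingleton] at hn
    exact hf₀ (Subtype.ext (LinearMap.ext fun x => Subsingleton.elim _ _))
  · let i := T.subtypeHom (radicalSubmodule_isSubcomodule X (T.coind X Y))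
    -- The maps `X → R` with values in `N`.
    let H : Submodule (X.EndRing)ᵐᵒᵖ (Hom X (T.radical X (T.coind X Y))) :=
      { carrier := {f | ∀ x, f.1 x ∈ N}
        zero_mem' := fun _ => N.zero_mem
        add_mem' := fun hf hg x => N.add_mem (hf x) (hg x)
        smul_mem' := fun t f hf x => hf (t.unop.1 x) }
    rcases eq_bot_or_eq_top H with h | h
    · left
      have hb := T.eq_bot_of_forall_hom_coind_eq_zero hT hfg hproj (T.map_isSubcomodule i hN)
        (fun f hf => by
          have hmem : ∀ x, f.1 x ∈ radicalSubmodule X (T.coind X Y) := fun x => by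
            obtain ⟨m, -, hm⟩ := hf x
            rw [← hm]; exact m.2
          let g : Hom X (T.radical X (T.coind X Y)) := T.codRestrictHom _ f hmem
          have hH : g ∈ H := fun x => by
            obtain ⟨m, hm, hx⟩ := hf x
            have : m = g.1 x := Subtype.ext hx
            exact this ▸ hm
          rw [h, Submodule.mem_bot] at hH
          exact Subtype.ext (LinearMap.ext fun x => congrArg Subtype.val
            (LinearMap.congr_fun (congrArg Subtype.val hH) x)))
      refine (Submodule.eq_bot_iff N).2 fun m hm => ?_
      have : i.1 m ∈ N.map i.1 := ⟨m, hm, rfl⟩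
      rw [hb] at this
      exact Subtype.ext this
    · exact Or.inr (T.eq_top_of_range_le hproj (T.torsion_radical X _) hN
        fun f => (h ▸ Submodule.mem_top : f ∈ H))

end RadicalCoind

/-- The map `[S] ↦ [Hom_C(X, S)]` on isomorphism classes. -/
def homClass (hproj : X.IsProjective) : SimpleComodClasses X → SimpleRightModuleClasses X.EndRing :=
  Quotient.lift
    (fun S => SimpleRightModuleClasses.mk (Hom X S.1) (T.isSimpleModule_hom hproj S.2.1 S.2.2))
    (fun _ _ h => Quotient.sound (IsIso.nonempty_hom_equiv h))

theorem homClass_injective (hproj : X.IsProjective) : Function.Injective (T.homClass hproj) := by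
  rintro ⟨S⟩ ⟨S'⟩ h
  obtain ⟨e⟩ := Quotient.exact h
  exact Quotient.sound (T.isIso_of_hom_equiv hproj S.2.1 S'.2.1 S.2.2 e)

theorem homClass_radical_coind (hT : T.RatExact) (hfg : X.IsFinGen) (hproj : X.IsProjective)
    (Y : Type u) [AddCommGroup Y] [Module (X.EndRing)ᵐᵒᵖ Y]
    (hY : IsSimpleModule (X.EndRing)ᵐᵒᵖ Y) :
    T.homClass hproj (SimpleComodClasses.mk (T.radical X (T.coind X Y))
      (T.isSimple_radical_coind Y hT hfg hproj hY)) = SimpleRightModuleClasses.mk Y hY :=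
  Quotient.sound (T.nonempty_hom_radical_coind_equiv Y hT hfg hproj)

end RationalPairing

end

end Corings

theorem mainTheorem2 {A C B : Type u} [Ring A] [AddCommGroup C] [Module A C] [Module Aᵐᵒᵖ C]
    [SMulCommClass A Aᵐᵒᵖ C] [Corings.Coring A C] [Ring B]
    (T : Corings.RationalPairing A C B) (hT : T.RatExact)
    (X : Corings.RComod A C) (hfg : X.IsFinGen) (hproj : X.IsProjective) :
    ∃ e : Corings.SimpleComodClasses X ≃ Corings.SimpleRightModuleClasses X.EndRing,
      (∀ (S : Corings.RComod A C)
          (hS : S.IsSimple ∧ ∃ f : Corings.RComod.Hom X S, f ≠ 0),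
        ∃ h : IsSimpleModule (X.EndRing)ᵐᵒᵖ (Corings.RComod.Hom X S),
          e (Corings.SimpleComodClasses.mk S hS)
            = Corings.SimpleRightModuleClasses.mk (Corings.RComod.Hom X S) h) ∧
      (∀ (Y : Type u) [AddCommGroup Y] [Module (X.EndRing)ᵐᵒᵖ Y]
          (hY : IsSimpleModule (X.EndRing)ᵐᵒᵖ Y),
        ∃ h : (T.radical X (T.coind X Y)).IsSimple ∧
            ∃ f : Corings.RComod.Hom X (T.radical X (T.coind X Y)), f ≠ 0,
          e.symm (Corings.SimpleRightModuleClasses.mk Y hY)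
            = Corings.SimpleComodClasses.mk (T.radical X (T.coind X Y)) h) := by
  have hbij : Function.Bijective (T.homClass hproj) := by
    refine ⟨T.homClass_injective hproj, ?_⟩
    rintro ⟨⟨Y, hY⟩⟩
    exact ⟨_, T.homClass_radical_coind hT hfg hproj Y hY⟩
  refine ⟨Equiv.ofBijective _ hbij, fun S hS => ⟨T.isSimpleModule_hom hproj hS.1 hS.2, rfl⟩,
    fun Y _ _ hY => ⟨T.isSimple_radical_coind Y hT hfg hproj hY, ?_⟩⟩
  rw [Equiv.symm_apply_eq]
  exact (T.homClass_radical_coind hT hfg hproj Y hY).symm
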